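/- **Notation.** Let $J=J_n=\begin{bmatrix}0&I_n\\-I_n&0\end{bmatrix}$. A matrix $A\in\mathbb C^{2n\times 2n}$ is Hamiltonian if $AJ=(AJ)^H$ and symplectic if $AJA^H=J$. A pair $(A,B)$ of square matrices is regular if $\det(A-\lambda B)\neq0$ for some $\lambda\in\mathbb C$. For a regular pair there are invertible $P,Q$ with $PAQ=K\oplus I$ and $PBQ=I\oplus N$ with $N$ nilpotent, and $\mathrm{ind}_\infty(A,B)$ is the least $\nu\ge0$ with $N^\nu=0$ (it is $0$ if $B$ is invertible). For symplectic $S_1,S_2$ and $X=[X_{ij}]_{1\le i,j\le2}\in\mathbb C^{2n\times2n}$ (with $n\times n$ blocks) put $$T_{S_1,S_2}(X)=\left(\begin{bmatrix}X_{12}&0\\X_{22}&I\end{bmatrix}S_2,\ \begin{bmatrix}I&X_{11}\\0&X_{21}\end{bmatrix}S_1\right),\qquad \mathbb S_{S_1,S_2}=\{T_{S_1,S_2}(X): X=X^H\}.$$ **Theorem.** Let $S_1,S_2\in\mathbb C^{2n\times2n}$ be symplectic and let $X_1\in\mathbb C^{2n\times2n}$ be Hermitian such that $(M_1,L_1)=T_{S_1,S_2}(X_1)$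 is regular with $\mathrm{ind}_\infty(M_1,L_1)\le1$. Let $\hat n+\ell=n$, let $U_1\in\mathbb C^{2n\times2\hat n}$, $U_0,U_\infty\in\mathbb C^{2n\times\ell}$ and $\mathbf U=[U_1\,|\,U_0,U_\infty]$, let $\hat S\in\mathbb C^{2\hat n\times 2\hat n}$ be symplectic and $\hat H\in\mathbb C^{2\hat n\times 2\hat n}$ Hamiltonian, such that $$\mathbf U^HJ_n\mathbf U=J_{\hat n}\oplus J_\ell,\quad M_1U_0=0,\quad L_1U_\infty=0,\quad M_1U_1=L_1U_1\hat S,\quad e^{\hat H}=\hat S .$$ Put $\mathbf V=(J_{\hat n}\oplus J_\ell)^H\mathbf U^HJ_n$ (so $\mathbf V=\mathbf U^{-1}$) and $$H=\mathbf U(\hat H\oplus0\oplus 0)\mathbf V,\quad \Pi_0=\mathbf U(I_{2\hat n}\oplus I_\ell\oplus0)\mathbf V,\quad \Pi_\infty=\mathbf U(I_{2\hat n}\oplus0\oplus I_\ell)\mathbf V .$$ Then $\Pi_0,\Pi_\infty$ are idempotent, $H$ is Hamiltonian and $M_1\Pi_0=L_1\Pi_\infty e^{H}$. Let moreover $X(t)$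 be a solution, on an open interval containing $1$, of $$\dot X(t)=M(t)\,H\,J\,M(t)^H,\qquad X(1)=X_1,\qquad\text{where } (M(t),L(t))=T_{S_1,S_2}(X(t)).$$ Then for all $t$ in this interval $$M(t)\Pi_0=L(t)\Pi_\infty e^{Ht},$$ $(M(t),L(t))\in\mathbb S_{S_1,S_2}$, and $$M(t)U_0=0,\qquad L(t)U_\infty=0,\qquad M(t)U_1=L(t)U_1e^{\hat Ht}.$$ -/

import Mathlib

noncomputable section

open Matrix

namespace SymplecticFlow

/-- Complex `2n × 2n` matrices, with rows and columns split into two blocks of size `n`. -/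
abbrev Mat (n : ℕ) : Type := Matrix (Fin n ⊕ Fin n) (Fin n ⊕ Fin n) ℂ

/-- The matrix `J_n = [[0, I], [-I, 0]]`. -/
def J (n : ℕ) : Mat n := fromBlocks 0 1 (-1) 0

/-- `H` is Hamiltonian: `H J = (H J)ᴴ`. -/
def IsHamiltonian {n : ℕ} (H : Mat n) : Prop := H * J n = (H * J n)ᴴ

/-- `S` is symplectic: `S J Sᴴ = J`. -/
def IsSymplectic {n : ℕ} (S : Mat n) : Prop := S * J n * Sᴴ = J n

/-- The block diagonal matrix `A ⊕ B ⊕ C` with blocks of sizes `2p`, `q`, `q`. -/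
def blockDiag3 {p q : ℕ} (A : Mat p) (B C : Matrix (Fin q) (Fin q) ℂ) :
    Matrix ((Fin p ⊕ Fin p) ⊕ (Fin q ⊕ Fin q)) ((Fin p ⊕ Fin p) ⊕ (Fin q ⊕ Fin q)) ℂ :=
  fromBlocks A 0 0 (fromBlocks B 0 0 C)

/-- The pair `(A, B)` is regular: `det (A - z B) ≠ 0` for some complex `z`. -/
def IsRegularPair {ι : Type} [Fintype ι] [DecidableEq ι] (A B : Matrix ι ι ℂ) : Prop :=
  ∃ z : ℂ, (A - z • B).det ≠ 0

/-- `HasIndexInfty A B ν`: the (regular) pair `(A, B)` has index `ν` at infinity. There are invertible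
`P`, `Q` with `P A Q = K ⊕ I` and `P B Q = I ⊕ N`, where `N` is nilpotent and `ν` is the least
exponent with `N ^ ν = 0`. As similarities of `K` and of `N` can be absorbed in `P` and `Q` and do not
change `ν`, the blocks are not required to be in Jordan form. The block `N` is empty, and then
`ν = 0`, exactly when `B` is invertible. -/
def HasIndexInfty {ι : Type} [Fintype ι] [DecidableEq ι] (A B : Matrix ι ι ℂ) (ν : ℕ) : Prop :=
  ∃ (r s : ℕ) (P : Matrix (Fin r ⊕ Fin s) ι ℂ) (Q : Matrix ι (Fin r ⊕ Fin s) ℂ)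
    (P' : Matrix ι (Fin r ⊕ Fin s) ℂ) (Q' : Matrix (Fin r ⊕ Fin s) ι ℂ)
    (K : Matrix (Fin r) (Fin r) ℂ) (N : Matrix (Fin s) (Fin s) ℂ),
    (P * P' = 1 ∧ P' * P = 1) ∧ (Q * Q' = 1 ∧ Q' * Q = 1) ∧
    P * A * Q = fromBlocks K 0 0 1 ∧ P * B * Q = fromBlocks 1 0 0 N ∧
    N ^ ν = 0 ∧ ∀ k < ν, N ^ k ≠ 0

/-- The first component `M = [[X₁₂, 0], [X₂₂, I]] S₂` of `T_{S₁,S₂}(X)`. -/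
def TM {n : ℕ} (S₂ X : Mat n) : Mat n := fromBlocks X.toBlocks₁₂ 0 X.toBlocks₂₂ 1 * S₂

/-- The second component `L = [[I, X₁₁], [0, X₂₁]] S₁` of `T_{S₁,S₂}(X)`. -/
def TL {n : ℕ} (S₁ X : Mat n) : Mat n := fromBlocks 1 X.toBlocks₁₁ 0 X.toBlocks₂₁ * S₁

/-- The transformation `T_{S₁,S₂}`. -/
def T {n : ℕ} (S₁ S₂ X : Mat n) : Mat n × Mat n := (TM S₂ X, TL S₁ X)

/-- The class of symplectic pairs generated by `S₁`, `S₂`: the image under `T_{S₁,S₂}` of the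
Hermitian matrices. -/
def pairClass {n : ℕ} (S₁ S₂ : Mat n) : Set (Mat n × Mat n) :=
  {p | ∃ X : Mat n, X.IsHermitian ∧ p = T S₁ S₂ X}

/-- An admissible choice of the matrices `𝐔 = [U₁ | U₀, U_∞]`, `Ŝ`, `Ĥ` attached to a regular
symplectic pair `(M, L)` with index at infinity at most one. The integers are `nh = n̂` and
`l = ℓ = n - n̂`. -/
structure DeflationData {n : ℕ} (M L : Mat n) where
  nh : ℕ
  l : ℕ
  size_eq : nh + l = n
  U₁ : Matrix (Fin n ⊕ Fin n) (Fin nh ⊕ Fin nh) ℂ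
  U₀ : Matrix (Fin n ⊕ Fin n) (Fin l) ℂ
  Uinf : Matrix (Fin n ⊕ Fin n) (Fin l) ℂ
  Shat : Mat nh
  Hhat : Mat nh
  /-- `𝐔ᴴ J_n 𝐔 = J_n̂ ⊕ J_ℓ`. -/
  gram : (fromCols U₁ (fromCols U₀ Uinf))ᴴ * J n * fromCols U₁ (fromCols U₀ Uinf) =
    fromBlocks (J nh) 0 0 (J l)
  zero_eq : M * U₀ = 0
  inf_eq : L * Uinf = 0
  finite_eq : M * U₁ = L * U₁ * Shat
  symplectic_Shat : IsSymplectic Shat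
  hamiltonian_Hhat : IsHamiltonian Hhat
  exp_Hhat : NormedSpace.exp Hhat = Shat

namespace DeflationData

variable {n : ℕ} {M L : Mat n}

/-- `𝐔 = [U₁ | U₀, U_∞]`. -/
def U (D : DeflationData M L) :
    Matrix (Fin n ⊕ Fin n) ((Fin D.nh ⊕ Fin D.nh) ⊕ (Fin D.l ⊕ Fin D.l)) ℂ :=
  fromCols D.U₁ (fromCols D.U₀ D.Uinf)

/-- `(J_n̂ ⊕ J_ℓ)ᴴ 𝐔ᴴ J_n`, which is the inverse of `𝐔`. -/
def V (D : DeflationData M L) :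
    Matrix ((Fin D.nh ⊕ Fin D.nh) ⊕ (Fin D.l ⊕ Fin D.l)) (Fin n ⊕ Fin n) ℂ :=
  (fromBlocks (J D.nh) 0 0 (J D.l))ᴴ * D.Uᴴ * J n

/-- `H = 𝐔 (Ĥ ⊕ 0) (J_n̂ ⊕ J_ℓ)ᴴ 𝐔ᴴ J_n`. -/
def H (D : DeflationData M L) : Mat n :=
  D.U * blockDiag3 (p := D.nh) (q := D.l) D.Hhat 0 0 * D.V

/-- `Π₀ = 𝐔 (I_{2n̂} ⊕ I_ℓ ⊕ 0) (J_n̂ ⊕ J_ℓ)ᴴ 𝐔ᴴ J_n`. -/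
def Pi₀ (D : DeflationData M L) : Mat n :=
  D.U * blockDiag3 (p := D.nh) (q := D.l) 1 1 0 * D.V

/-- `Π_∞ = 𝐔 (I_{2n̂} ⊕ 0 ⊕ I_ℓ) (J_n̂ ⊕ J_ℓ)ᴴ 𝐔ᴴ J_n`. -/
def Piinf (D : DeflationData M L) : Mat n :=
  D.U * blockDiag3 (p := D.nh) (q := D.l) 1 0 1 * D.V

end DeflationData

end SymplecticFlow

end

open scoped Matrix
open SymplecticFlow

/-!
Write `M(t) = TM S₂ (X t)`, `L(t) = TL S₁ (X t)`, and let
`E = [[0, I], [0, 0]]`, the matrix `shift n`.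

The right-hand side `M H J Mᴴ` is Hermitian because `H` is Hamiltonian, so `X(t)` stays Hermitian
(`isHermitian_of_flow`). For Hermitian `X` the block structure of the pair gives the identities
`Mᴴ Eᵀ S₂ = S₂ᴴ E M - J` and `Mᴴ E S₁ = S₂ᴴ E L` (`conjTranspose_TM_mul_shift_transpose`,
`conjTranspose_TM_mul_shift`), whose left-hand sides are exactly the factors in
`M' = M H J Mᴴ Eᵀ S₂` and `L' = M H J Mᴴ E S₁`. Together with `H Π₀ = H = Π₀ H` they turn the
derivative of the residual `F(t) = M(t) Π₀ - L(t) Π_∞ exp (t H)` into a homogeneous linear equation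
`F' = (M H J S₂ᴴ E) F + F H` (`hasDerivAt_residual`). Since `F(1) = 0`, uniqueness for linear
differential equations (`eq_zero_of_hasDerivAt_mul_add_mul`) gives `F = 0` on the interval.

The relation `M Π₀ = L Π_∞ exp (t H)` is equivalent to the three relations on the blocks of
`𝐔 = [U₁ | U₀, U_∞]` (`DeflationData.mul_Pi₀_eq_iff`): as `𝐕 𝐔 = I`, multiplication by `𝐔` on the
right separates the blocks, and `exp (t H) U₁ = U₁ exp (t Ĥ)`, whereas `exp (t H)` fixes
`U₀` and `U_∞`. This is used at `t = 1` to get `F(1) = 0`, and for every `t` to read off the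
conclusion.
-/

/-! ### Homogeneous linear differential equations -/

/-- A solution of the Sylvester-type linear equation `F' = G F + F H` on an open interval, with `G`
continuous, vanishes identically as soon as it vanishes at one point. -/
theorem eq_zero_of_hasDerivAt_mul_add_mul {R : Type*} [NormedRing R] [NormedAlgebra ℝ R]
    {I : Set ℝ} (hI : IsOpen I) (hI' : I.OrdConnected) {t₀ : ℝ} (ht₀ : t₀ ∈ I)
    {F G : ℝ → R} {H : R} (hG : ContinuousOn G I)
    (hF : ∀ t ∈ I, HasDerivAt F (G t * F t + F t * H) t) (h₀ : F t₀ = 0) :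
    ∀ t ∈ I, F t = 0 := by
  intro t ht
  -- Slightly enlarge the segment between `t₀` and `t`, so that both points are interior.
  obtain ⟨a, haI, ha⟩ : ∃ a ∈ I, a < min t₀ t := by
    have hmin : min t₀ t ∈ I := by rcases min_choice t₀ t with h | h <;> rwa [h]
    obtain ⟨ε, hε, h⟩ := Metric.isOpen_iff.1 hI _ hmin
    refine ⟨min t₀ t - ε / 2, h ?_, by linarith⟩
    rw [Real.ball_eq_Ioo]
    exact ⟨by linarith, by linarith⟩
  obtain ⟨b, hbI, hb⟩ : ∃ b ∈ I, max t₀ t < b := by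
    have hmax : max t₀ t ∈ I := by rcases max_choice t₀ t with h | h <;> rwa [h]
    obtain ⟨ε, hε, h⟩ := Metric.isOpen_iff.1 hI _ hmax
    refine ⟨max t₀ t + ε / 2, h ?_, by linarith⟩
    rw [Real.ball_eq_Ioo]
    exact ⟨by linarith, by linarith⟩
  have hsub : Set.Icc a b ⊆ I := hI'.out haI hbI
  obtain ⟨C, hC⟩ := isCompact_Icc.exists_bound_of_continuousOn (hG.mono hsub)
  have hC₀ : 0 ≤ C := (norm_nonneg _).trans
    (hC a ⟨le_rfl, ((ha.trans_le (min_le_left _ _)).trans ((le_max_left _ _).trans_lt hb)).le⟩)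
  have hlip : ∀ s ∈ Set.Ioo a b, LipschitzOnWith (⟨C, hC₀⟩ + ‖H‖₊)
      (fun Y : R => G s * Y + Y * H) Set.univ := by
    intro s hs
    refine LipschitzOnWith.of_dist_le_mul fun Y _ Z _ => ?_
    rw [dist_eq_norm, dist_eq_norm]
    have hYZ : G s * Y + Y * H - (G s * Z + Z * H) = G s * (Y - Z) + (Y - Z) * H := by
      noncomm_ring
    calc ‖G s * Y + Y * H - (G s * Z + Z * H)‖
        ≤ ‖G s‖ * ‖Y - Z‖ + ‖Y - Z‖ * ‖H‖ := by
          rw [hYZ]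
          exact (norm_add_le _ _).trans (add_le_add (norm_mul_le _ _) (norm_mul_le _ _))
      _ ≤ C * ‖Y - Z‖ + ‖Y - Z‖ * ‖H‖ := by
          gcongr
          exact hC s (Set.Ioo_subset_Icc_self hs)
      _ = (C + ‖H‖) * ‖Y - Z‖ := by ring
  have key := ODE_solution_unique_of_mem_Ioo (v := fun s Y => G s * Y + Y * H)
    (f := F) (g := fun _ => 0) (t₀ := t₀) hlip
    ⟨ha.trans_le (min_le_left _ _), (le_max_left _ _).trans_lt hb⟩
    (fun s hs => ⟨hF s (hsub (Set.Ioo_subset_Icc_self hs)), Set.mem_univ _⟩)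
    (fun s _ => ⟨by simpa using hasDerivAt_const s (0 : R), Set.mem_univ _⟩) h₀
  exact key ⟨ha.trans_le (min_le_right _ _), (le_max_right _ _).trans_lt hb⟩

/-! ### Exponentials and intertwining relations -/

section Exp

open Matrix
open scoped Matrix.Norms.Operator

/-- The exponential respects intertwining relations `A P = P B` with a rectangular matrix `P`. -/
theorem Matrix.exp_mul_eq_mul_exp {m k : Type*} [Fintype m] [DecidableEq m] [Fintype k]
    [DecidableEq k] {A : Matrix m m ℂ} {B : Matrix k k ℂ} {P : Matrix m k ℂ}
    (h : A * P = P * B) : NormedSpace.exp A * P = P * NormedSpace.exp B := by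
  have hpow : ∀ i : ℕ, A ^ i * P = P * B ^ i := by
    intro i
    induction i with
    | zero => simp
    | succ i ih => rw [pow_succ, Matrix.mul_assoc, h, ← Matrix.mul_assoc, ih, Matrix.mul_assoc,
        ← pow_succ]
  have hA := (NormedSpace.exp_series_hasSum_exp' (𝕂 := ℂ) A).map
    (Matrix.addMonoidHomMulRight P) (by
      change Continuous fun Y : Matrix m m ℂ => Y * P
      fun_prop)
  have hB := (NormedSpace.exp_series_hasSum_exp' (𝕂 := ℂ) B).map
    (Matrix.addMonoidHomMulLeft P) (by
      change Continuous fun Y : Matrix k k ℂ => P * Y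
      fun_prop)
  refine hA.unique ?_
  have hfun : (Matrix.addMonoidHomMulRight P) ∘ (fun i : ℕ => ((i.factorial : ℂ))⁻¹ • A ^ i) =
      (Matrix.addMonoidHomMulLeft P) ∘ fun i : ℕ => ((i.factorial : ℂ))⁻¹ • B ^ i := by
    funext i
    simp [Matrix.addMonoidHomMulRight, Matrix.addMonoidHomMulLeft, hpow]
  rw [hfun]
  exact hB

theorem Matrix.exp_mul_eq_self {m k : Type*} [Fintype m] [DecidableEq m] [Fintype k]
    [DecidableEq k] {A : Matrix m m ℂ} {P : Matrix m k ℂ} (h : A * P = 0) :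
    NormedSpace.exp A * P = P := by
  simpa using Matrix.exp_mul_eq_mul_exp (A := A) (B := (0 : Matrix k k ℂ)) (P := P)
    (by simpa using h)

end Exp

namespace SymplecticFlow

open Matrix

/-! ### The matrix `J` and symplectic pairs -/

theorem J_mul_J (n : ℕ) : J n * J n = -1 := by
  simp [J, fromBlocks_multiply, ← fromBlocks_one, fromBlocks_neg]

theorem conjTranspose_J (n : ℕ) : (J n)ᴴ = -J n := by
  simp [J, fromBlocks_conjTranspose, fromBlocks_neg]

/-- Symplecticity is stable under conjugate transposition. -/
theorem IsSymplectic.conjTranspose_mul {n : ℕ} {S : Mat n} (h : IsSymplectic S) :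
    Sᴴ * J n * S = J n := by
  have h1 : S * (-(J n * Sᴴ * J n)) = 1 := by
    have h' : S * J n * Sᴴ = J n := h
    calc S * (-(J n * Sᴴ * J n)) = -((S * J n * Sᴴ) * J n) := by
          simp only [Matrix.mul_neg, Matrix.mul_assoc]
      _ = 1 := by rw [h', J_mul_J, neg_neg]
  have h2 : J n * (-(J n * Sᴴ * J n) * S) = J n := by
    rw [mul_eq_one_comm.1 h1, Matrix.mul_one]
  calc Sᴴ * J n * S = -((J n * J n) * (Sᴴ * J n * S)) := by simp [J_mul_J]
    _ = J n * (-(J n * Sᴴ * J n) * S) := by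
      simp only [Matrix.mul_neg, Matrix.neg_mul, Matrix.mul_assoc]
    _ = J n := h2

/-- The nilpotent matrix `[[0, I], [0, 0]]`, which moves the first block column to the second. -/
def shift (n : ℕ) : Mat n := fromBlocks 0 1 0 0

theorem TM_eq {n : ℕ} (S₂ X : Mat n) :
    TM S₂ X = X * ((shift n)ᵀ * S₂) + fromBlocks 0 0 0 1 * S₂ := by
  rw [← Matrix.mul_assoc, ← Matrix.add_mul, TM]
  conv_rhs => rw [← fromBlocks_toBlocks X]
  simp [shift, fromBlocks_transpose, fromBlocks_multiply, fromBlocks_add]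

theorem TL_eq {n : ℕ} (S₁ X : Mat n) :
    TL S₁ X = X * (shift n * S₁) + fromBlocks 1 0 0 0 * S₁ := by
  rw [← Matrix.mul_assoc, ← Matrix.add_mul, TL]
  conv_rhs => rw [← fromBlocks_toBlocks X]
  simp [shift, fromBlocks_multiply, fromBlocks_add]

section Hermitian

variable {n : ℕ} {S₁ S₂ X : Mat n}

theorem conjTranspose_TM (hX : X.IsHermitian) :
    (TM S₂ X)ᴴ = S₂ᴴ * fromBlocks X.toBlocks₂₁ X.toBlocks₂₂ 0 1 := by
  rw [← fromBlocks_toBlocks X, isHermitian_fromBlocks_iff] at hX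
  obtain ⟨-, h12, -, h22⟩ := hX
  rw [TM, conjTranspose_mul, fromBlocks_conjTranspose, h12, h22.eq]
  simp

theorem conjTranspose_TM_mul_shift_transpose (hS₂ : IsSymplectic S₂) (hX : X.IsHermitian) :
    (TM S₂ X)ᴴ * ((shift n)ᵀ * S₂) = S₂ᴴ * shift n * TM S₂ X - J n := by
  have h : (fromBlocks X.toBlocks₂₁ X.toBlocks₂₂ 0 1 : Mat n) * (shift n)ᵀ =
      shift n * fromBlocks X.toBlocks₁₂ 0 X.toBlocks₂₂ 1 - J n := by
    simp [shift, J, fromBlocks_transpose, fromBlocks_multiply, sub_eq_add_neg, fromBlocks_neg,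
      fromBlocks_add]
  calc (TM S₂ X)ᴴ * ((shift n)ᵀ * S₂)
      = S₂ᴴ * (fromBlocks X.toBlocks₂₁ X.toBlocks₂₂ 0 1 * (shift n)ᵀ) * S₂ := by
        rw [conjTranspose_TM hX]; simp only [Matrix.mul_assoc]
    _ = S₂ᴴ * shift n * TM S₂ X - S₂ᴴ * J n * S₂ := by
        rw [h, TM, Matrix.mul_sub, Matrix.sub_mul]; simp only [Matrix.mul_assoc]
    _ = _ := by rw [hS₂.conjTranspose_mul]

theorem conjTranspose_TM_mul_shift (hX : X.IsHermitian) :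
    (TM S₂ X)ᴴ * (shift n * S₁) = S₂ᴴ * shift n * TL S₁ X := by
  have h : (fromBlocks X.toBlocks₂₁ X.toBlocks₂₂ 0 1 : Mat n) * shift n =
      shift n * fromBlocks 1 X.toBlocks₁₁ 0 X.toBlocks₂₁ := by
    simp [shift, fromBlocks_multiply]
  calc (TM S₂ X)ᴴ * (shift n * S₁)
      = S₂ᴴ * (fromBlocks X.toBlocks₂₁ X.toBlocks₂₂ 0 1 * shift n) * S₁ := by
        rw [conjTranspose_TM hX]; simp only [Matrix.mul_assoc]
    _ = _ := by rw [h, TL]; simp only [Matrix.mul_assoc]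

end Hermitian

/-! ### The deflating projections -/

namespace DeflationData

variable {n : ℕ} {M L : Mat n} (D : DeflationData M L)

theorem V_mul_U : D.V * D.U = 1 := by
  have hg : D.Uᴴ * J n * D.U = fromBlocks (J D.nh) 0 0 (J D.l) := D.gram
  rw [V, Matrix.mul_assoc, Matrix.mul_assoc, ← Matrix.mul_assoc D.Uᴴ, hg]
  simp [fromBlocks_conjTranspose, fromBlocks_multiply, conjTranspose_J, J_mul_J, fromBlocks_one]

theorem U_mul_V : D.U * D.V = 1 := by
  have e : ((Fin D.nh ⊕ Fin D.nh) ⊕ (Fin D.l ⊕ Fin D.l)) ≃ (Fin n ⊕ Fin n) :=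
    Fintype.equivOfCardEq (by have := D.size_eq; simp; omega)
  exact (Matrix.mul_eq_one_comm_of_equiv e).1 D.V_mul_U

/-- The matrices `𝐔 (A ⊕ B ⊕ C) 𝐕` multiply blockwise. -/
theorem conj_mul_conj (A A' : Mat D.nh) (B C B' C' : Matrix (Fin D.l) (Fin D.l) ℂ) :
    (D.U * blockDiag3 A B C * D.V) * (D.U * blockDiag3 A' B' C' * D.V) =
      D.U * blockDiag3 (A * A') (B * B') (C * C') * D.V := by
  have h : blockDiag3 A B C * blockDiag3 A' B' C' =
      blockDiag3 (A * A') (B * B') (C * C') := by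
    simp [blockDiag3, fromBlocks_multiply]
  rw [← h]
  calc _ = D.U * blockDiag3 A B C * (D.V * D.U) * (blockDiag3 A' B' C' * D.V) := by
        simp only [Matrix.mul_assoc]
    _ = _ := by rw [V_mul_U, Matrix.mul_one]; simp only [Matrix.mul_assoc]

theorem conj_mul_U (A : Mat D.nh) (B C : Matrix (Fin D.l) (Fin D.l) ℂ) :
    (D.U * blockDiag3 A B C * D.V) * D.U =
      fromCols (D.U₁ * A) (fromCols (D.U₀ * B) (D.Uinf * C)) := by
  rw [Matrix.mul_assoc, V_mul_U, Matrix.mul_one, U, blockDiag3, fromCols_mul_fromBlocks,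
    fromCols_mul_fromBlocks]
  simp

theorem isIdempotentElem_Pi₀ : IsIdempotentElem D.Pi₀ := by
  rw [IsIdempotentElem, Pi₀, conj_mul_conj]; simp

theorem isIdempotentElem_Piinf : IsIdempotentElem D.Piinf := by
  rw [IsIdempotentElem, Piinf, conj_mul_conj]; simp

theorem H_mul_Pi₀ : D.H * D.Pi₀ = D.H := by
  rw [H, Pi₀, conj_mul_conj]; simp

theorem Pi₀_mul_H : D.Pi₀ * D.H = D.H := by
  rw [H, Pi₀, conj_mul_conj]; simp

theorem isHamiltonian_H : IsHamiltonian D.H := by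
  have hV : D.V * J n = fromBlocks (J D.nh) 0 0 (J D.l) * D.Uᴴ := by
    rw [V, Matrix.mul_assoc, J_mul_J]
    simp [fromBlocks_conjTranspose, conjTranspose_J, fromBlocks_neg, ← Matrix.neg_mul]
  have h : D.H * J n =
      D.U * blockDiag3 (p := D.nh) (q := D.l) (D.Hhat * J D.nh) 0 0 * D.Uᴴ := by
    rw [H, Matrix.mul_assoc, hV, ← Matrix.mul_assoc, Matrix.mul_assoc D.U]
    congr 2
    simp [blockDiag3, fromBlocks_multiply]
  have hh : (D.Hhat * J D.nh)ᴴ = D.Hhat * J D.nh := D.hamiltonian_Hhat.symm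
  have hb : (blockDiag3 (D.Hhat * J D.nh) (0 : Matrix (Fin D.l) (Fin D.l) ℂ) 0)ᴴ =
      blockDiag3 (D.Hhat * J D.nh) 0 0 := by
    rw [blockDiag3, fromBlocks_conjTranspose, hh]
    simp
  unfold IsHamiltonian
  rw [h, conjTranspose_mul, conjTranspose_mul, hb, conjTranspose_conjTranspose, Matrix.mul_assoc]

theorem H_mul_U : D.H * D.U = fromCols (D.U₁ * D.Hhat) (fromCols 0 0) := by
  rw [H, conj_mul_U]; simp

theorem exp_smul_H_mul_U (z : ℂ) :
    NormedSpace.exp (z • D.H) * D.U =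
      fromCols (D.U₁ * NormedSpace.exp (z • D.Hhat)) (fromCols D.U₀ D.Uinf) := by
  have h := D.H_mul_U
  rw [U, mul_fromCols, mul_fromCols, fromCols_ext_iff, fromCols_ext_iff] at h
  obtain ⟨h1, h0, hinf⟩ := h
  rw [U, mul_fromCols, mul_fromCols, Matrix.exp_mul_eq_mul_exp (B := z • D.Hhat) (by simp [h1]),
    Matrix.exp_mul_eq_self (by simp [h0]), Matrix.exp_mul_eq_self (by simp [hinf])]

/-- The relation between the pair and the projections, read off on the column blocks of `𝐔`. The
pair `(M', L')` need not be the one from which the deflation data are built. -/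
theorem mul_Pi₀_eq_iff (M' L' : Mat n) (z : ℂ) :
    M' * D.Pi₀ = L' * D.Piinf * NormedSpace.exp (z • D.H) ↔
      M' * D.U₁ = L' * D.U₁ * NormedSpace.exp (z • D.Hhat) ∧ M' * D.U₀ = 0 ∧ L' * D.Uinf = 0 := by
  have hcancel : ∀ A B : Mat n, A = B ↔ A * D.U = B * D.U := fun A B =>
    ⟨fun h => by rw [h], fun h => by
      rw [← Matrix.mul_one A, ← Matrix.mul_one B, ← U_mul_V D, ← Matrix.mul_assoc,
        ← Matrix.mul_assoc, h]⟩
  have h0 : D.Pi₀ * D.U = fromCols D.U₁ (fromCols D.U₀ 0) := by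
    rw [Pi₀, conj_mul_U]; simp
  have hinf : D.Piinf * (NormedSpace.exp (z • D.H) * D.U) =
      fromCols (D.U₁ * NormedSpace.exp (z • D.Hhat)) (fromCols 0 D.Uinf) := by
    have h := D.conj_mul_U 1 0 1
    rw [← Piinf, U, mul_fromCols, mul_fromCols, fromCols_ext_iff, fromCols_ext_iff] at h
    obtain ⟨h1, h0, hinf⟩ := h
    rw [exp_smul_H_mul_U, mul_fromCols, mul_fromCols, ← Matrix.mul_assoc, h1, h0, hinf]
    simp
  rw [hcancel, Matrix.mul_assoc M', h0, Matrix.mul_assoc, Matrix.mul_assoc L', hinf]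
  simp only [mul_fromCols, fromCols_ext_iff, Matrix.mul_zero, Matrix.mul_assoc]
  tauto

/-- At `z = 1` the relation is part of the data. -/
theorem mul_Pi₀_eq : M * D.Pi₀ = L * D.Piinf * NormedSpace.exp D.H := by
  have h := (D.mul_Pi₀_eq_iff M L 1).2
    ⟨by rw [one_smul, D.exp_Hhat]; exact D.finite_eq, D.zero_eq, D.inf_eq⟩
  rwa [one_smul] at h

end DeflationData

/-! ### The flow -/

section Flow

open scoped Matrix.Norms.Operator

variable {n : ℕ} {S₁ S₂ : Mat n} {X : ℝ → Mat n}

theorem hasDerivAt_TM {W : Mat n} {t : ℝ} (h : HasDerivAt X W t) :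
    HasDerivAt (fun s => TM S₂ (X s)) (W * ((shift n)ᵀ * S₂)) t := by
  simp only [TM_eq]
  exact (h.mul_const _).add_const _

theorem hasDerivAt_TL {W : Mat n} {t : ℝ} (h : HasDerivAt X W t) :
    HasDerivAt (fun s => TL S₁ (X s)) (W * (shift n * S₁)) t := by
  simp only [TL_eq]
  exact (h.mul_const _).add_const _

/-- The flow `X' = M H J Mᴴ` with `H` Hamiltonian preserves Hermitian matrices. -/
theorem isHermitian_of_flow {I : Set ℝ} (hI : IsOpen I) (hI' : I.OrdConnected) {t₀ : ℝ}
    (ht₀ : t₀ ∈ I) {H : Mat n} (hH : IsHamiltonian H)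
    (hX : ∀ t ∈ I, HasDerivAt X (TM S₂ (X t) * H * J n * (TM S₂ (X t))ᴴ) t)
    (h₀ : (X t₀).IsHermitian) : ∀ t ∈ I, (X t).IsHermitian := by
  have hW : ∀ M : Mat n, (M * H * J n * Mᴴ)ᴴ = M * H * J n * Mᴴ := by
    intro M
    have hh : (H * J n)ᴴ = H * J n := hH.symm
    rw [Matrix.mul_assoc M H, conjTranspose_mul, conjTranspose_mul, hh, conjTranspose_conjTranspose,
      ← Matrix.mul_assoc]
  -- The topology of the norm has to be named for `HasDerivAt.star` to find this instance.
  have : @ContinuousStar (Mat n) PseudoMetricSpace.toUniformSpace.toTopologicalSpace _ :=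
    ⟨continuous_id.matrix_conjTranspose⟩
  have key := eq_zero_of_hasDerivAt_mul_add_mul (F := fun t => (X t)ᴴ - X t) (G := fun _ => 0)
    (H := 0) hI hI' ht₀ continuousOn_const (fun t ht => by
      refine ((hX t ht).star.sub (hX t ht)).congr_deriv ?_
      rw [star_eq_conjTranspose, hW]
      simp) (by rw [h₀.eq, sub_self])
  exact fun t ht => sub_eq_zero.1 (key t ht)

/-- The residual `M(t) Π₀ - L(t) Π_∞ exp (t H)` satisfies a homogeneous linear equation. -/
theorem hasDerivAt_residual (hS₂ : IsSymplectic S₂) {H P Q : Mat n} (hHP : H * P = H)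
    (hPH : P * H = H) {t : ℝ} (hXt : (X t).IsHermitian)
    (hX : HasDerivAt X (TM S₂ (X t) * H * J n * (TM S₂ (X t))ᴴ) t) :
    HasDerivAt (fun s : ℝ => TM S₂ (X s) * P - TL S₁ (X s) * Q * NormedSpace.exp (s • H))
      ((TM S₂ (X t) * H * J n * S₂ᴴ * shift n) *
          (TM S₂ (X t) * P - TL S₁ (X t) * Q * NormedSpace.exp (t • H)) +
        (TM S₂ (X t) * P - TL S₁ (X t) * Q * NormedSpace.exp (t • H)) * H) t := by
  have h := ((hasDerivAt_TM (S₂ := S₂) hX).mul_const P).sub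
    (((hasDerivAt_TL (S₁ := S₁) hX).mul_const Q).mul (hasDerivAt_exp_smul_const (𝕂 := ℝ) H t))
  refine h.congr_deriv ?_
  rw [Matrix.mul_assoc _ _ ((shift n)ᵀ * S₂), Matrix.mul_assoc _ _ (shift n * S₁),
    conjTranspose_TM_mul_shift_transpose hS₂ hXt, conjTranspose_TM_mul_shift hXt]
  generalize TM S₂ (X t) = M
  generalize TL S₁ (X t) = L
  -- The term `-J` contributes `M H J (-J) P = M H P = M H = M P H`.
  have hJ : M * H * J n * J n * P = -(M * P * H) := by
    rw [Matrix.mul_assoc (M * H), J_mul_J, Matrix.mul_neg, Matrix.mul_one, Matrix.neg_mul,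
      Matrix.mul_assoc, Matrix.mul_assoc, hHP, hPH]
  have hexp : M * H * J n * (S₂ᴴ * shift n * M - J n) * P =
      M * H * J n * S₂ᴴ * shift n * M * P + M * P * H := by
    rw [Matrix.mul_sub, Matrix.sub_mul, hJ]
    simp only [Matrix.mul_assoc, sub_neg_eq_add]
  have hZ : ∀ Z : Mat n, M * H * J n * S₂ᴴ * shift n * M * P + M * P * H -
      (M * H * J n * (S₂ᴴ * shift n * L) * Q * Z + L * Q * (Z * H)) =
      (M * H * J n * S₂ᴴ * shift n) * (M * P - L * Q * Z) + (M * P - L * Q * Z) * H := by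
    intro Z
    simp only [Matrix.mul_sub, Matrix.sub_mul, ← Matrix.mul_assoc]
    abel
  rw [hexp]
  exact hZ _

theorem residual_eq_zero (hS₂ : IsSymplectic S₂) {I : Set ℝ} (hI : IsOpen I)
    (hI' : I.OrdConnected) {t₀ : ℝ} (ht₀ : t₀ ∈ I) {H P Q : Mat n} (hHP : H * P = H)
    (hPH : P * H = H) (hherm : ∀ t ∈ I, (X t).IsHermitian)
    (hX : ∀ t ∈ I, HasDerivAt X (TM S₂ (X t) * H * J n * (TM S₂ (X t))ᴴ) t)
    (h₀ : TM S₂ (X t₀) * P = TL S₁ (X t₀) * Q * NormedSpace.exp (t₀ • H)) :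
    ∀ t ∈ I, TM S₂ (X t) * P = TL S₁ (X t) * Q * NormedSpace.exp (t • H) := by
  have hcont : ContinuousOn (fun t => TM S₂ (X t) * H * J n * S₂ᴴ * shift n) I := by
    intro t ht
    have hM := (hasDerivAt_TM (S₂ := S₂) (hX t ht)).continuousAt
    exact ((((hM.mul_const _).mul_const _).mul_const _).mul_const _).continuousWithinAt
  have key := eq_zero_of_hasDerivAt_mul_add_mul hI hI' ht₀ hcont
    (fun t ht => hasDerivAt_residual (S₁ := S₁) (Q := Q) hS₂ hHP hPH (hherm t ht) (hX t ht))
    (sub_eq_zero.2 h₀)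
  exact fun t ht => sub_eq_zero.1 (key t ht)

end Flow

end SymplecticFlow

theorem theorem3p2 (n : ℕ) (S₁ S₂ X₁ : Mat n)
    (hS₁ : IsSymplectic S₁) (hS₂ : IsSymplectic S₂)
    (hX₁ : X₁.IsHermitian)
    (hreg : IsRegularPair (TM S₂ X₁) (TL S₁ X₁))
    (hind : ∃ ν ≤ 1, HasIndexInfty (TM S₂ X₁) (TL S₁ X₁) ν)
    (D : DeflationData (TM S₂ X₁) (TL S₁ X₁))
    (I : Set ℝ) (hI : IsOpen I) (hI' : I.OrdConnected) (h1 : (1 : ℝ) ∈ I)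
    (X : ℝ → Mat n)
    (hX : ∀ t ∈ I, HasDerivAt X
      (TM S₂ (X t) * D.H * J n * (TM S₂ (X t))ᴴ) t)
    (hX1 : X 1 = X₁) :
    IsIdempotentElem D.Pi₀ ∧ IsIdempotentElem D.Piinf ∧ IsHamiltonian D.H ∧
    TM S₂ X₁ * D.Pi₀ = TL S₁ X₁ * D.Piinf * NormedSpace.exp D.H ∧
    ∀ t ∈ I,
      TM S₂ (X t) * D.Pi₀ =
        TL S₁ (X t) * D.Piinf * NormedSpace.exp ((t : ℂ) • D.H) ∧
      T S₁ S₂ (X t) ∈ pairClass S₁ S₂ ∧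
      TM S₂ (X t) * D.U₀ = 0 ∧
      TL S₁ (X t) * D.Uinf = 0 ∧
      TM S₂ (X t) * D.U₁ =
        TL S₁ (X t) * D.U₁ * NormedSpace.exp ((t : ℂ) • D.Hhat) := by
  subst hX1
  have hherm := isHermitian_of_flow hI hI' h1 D.isHamiltonian_H hX hX₁
  have hrel := residual_eq_zero (S₁ := S₁) (Q := D.Piinf) hS₂ hI hI' h1 D.H_mul_Pi₀ D.Pi₀_mul_H
    hherm hX (by rw [one_smul]; exact D.mul_Pi₀_eq)
  refine ⟨D.isIdempotentElem_Pi₀, D.isIdempotentElem_Piinf, D.isHamiltonian_H, D.mul_Pi₀_eq,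
    fun t ht => ?_⟩
  have h : TM S₂ (X t) * D.Pi₀ =
      TL S₁ (X t) * D.Piinf * NormedSpace.exp ((t : ℂ) • D.H) := by
    rw [Complex.coe_smul]
    exact hrel t ht
  obtain ⟨hU₁, hU₀, hUinf⟩ := (D.mul_Pi₀_eq_iff _ _ _).1 h
  exact ⟨h, ⟨X t, hherm t ht, rfl⟩, hU₀, hUinf, hU₁⟩
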